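/- A *Cantor fan* is a space homeomorphic to $\bigcup_{c\in K}A_c\subseteq\mathbb R^2$, where $K\subseteq[0,1]$ is a Cantor set and $A_c$ is the straight segment from $(0,0)$ to $(c,-1)$. A continuous self-map $f$ of a compact metrizable space $X$ is *chaotic in the sense of Devaney* if $(X,f)$ is transitive (for all non-empty open $U,V\subseteq X$ there is $n\ge 0$ with $f^n(U)\cap V\neq\emptyset$) and the set of its periodic points (points $p$ with $f^n(p)=p$ for some $n\ge 1$) is dense in $X$. Let $X=[0,1]\cup[2,3]\cup[4,5]\cup[6,7]$ and let $f_1,f_2,f_3:X\to X$ be the homeomorphisms $$f_1(x)=\begin{cases}x^2,&x\in[0,1]\\(x-2)^{1/2}+2,&x\in[2,3]\\(x-4)^3+4,&x\in[4,5]\\(x-6)^{1/3}+6,&x\in[6,7]\end{cases}\qquad f_2(x)=\begin{cases}x+2,&x\in[0,1]\cup[4,5]\\x-2,&x\in[2,3]\cup[6,7]\end{cases}$$ $$f_3(x)=\begin{cases}x^2,&x\in[0,1]\\x+2,&x\in[2,3]\\x-2,&x\in[4,5]\\(x-6)^{1/3}+6,&x\in[6,7].\end{cases}$$ Let $F=\Gamma(f_1)\cup\Gamma(f_2)\cup\Gamma(f_3)\subseteq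 X\times X$ be the union of their graphs. Let $X_F^+$ be the space of all sequences $(x_1,x_2,\dots)$ in $X$ with $(x_i,x_{i+1})\in F$ for all $i\ge 1$, and let $X_F$ be the space of all bi-infinite sequences $(x_i)_{i\in\mathbb Z}$ in $X$ with $(x_i,x_{i+1})\in F$ for all $i\in\mathbb Z$ (both with the product topology). Let $\sigma_F^+$ and $\sigma_F$ be the shifts $(x_i)\mapsto(x_{i+1})$ on them. On $X_F^+$ and on $X_F$ consider the equivalence relation that identifies $\mathbf x$ and $\mathbf y$ if and only if $\mathbf x=\mathbf y$ or all coordinates of both $\mathbf x$ and $\mathbf y$ belong to $\{0,2,4,6\}$. Let $(\sigma_F^+)^\star$ and $\sigma_F^\star$ be the maps induced by the shifts on the quotient spaces $X_F^+/{\sim_+}$ and $X_F/{\sim}$. **Theorem.** Let $C$ be a Cantor fan. 1. There is a continuous map $f:C\to C$ that is not a homeomorphism and such that $(C,f)$ is chaotic in the sense of Devaney; moreover $f$ can be chosen topologically conjugate to $(\sigma_F^+)^\star$ on $X_F^+/{\sim_+}$. 2. There is a homeomorphism $h:C\to C$ such that $(C,h)$ is chaotic in the sense of Devaney; moreover $h$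 can be chosen topologically conjugate to $\sigma_F^\star$ on $X_F/{\sim}$. In particular, both quotient spaces are Cantor fans. -/

import Mathlib

namespace CantorFanChaos

open Set

/-! ### Chaotic dynamical systems -/

/-- `f` is (topologically) transitive: for all non-empty open `U`, `V` there is `n ≥ 0` such that
`f^n(U)` meets `V`. -/
def Transitive {X : Type*} [TopologicalSpace X] (f : X → X) : Prop :=
  ∀ U V : Set X, IsOpen U → U.Nonempty → IsOpen V → V.Nonempty →
    ∃ n : ℕ, ((f^[n] '' U) ∩ V).Nonempty

/-- Chaos in the sense of Devaney: transitivity together with a dense set of periodic points.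
The set `Function.periodicPts f` is the set of `p` with `f^n p = p` for some `n > 0`. -/
def DevaneyChaotic {X : Type*} [TopologicalSpace X] (f : X → X) : Prop :=
  Transitive f ∧ Dense (Function.periodicPts f)

/-- `(Y, g)` is topologically conjugate to `(X, f)`. -/
def TopConjugate {X Y : Type*} [TopologicalSpace X] [TopologicalSpace Y]
    (f : X → X) (g : Y → Y) : Prop :=
  ∃ φ : X ≃ₜ Y, φ ∘ f = g ∘ φ

/-! ### The Cantor fan -/

/-- A Cantor set in the real line: a subset homeomorphic to the ternary Cantor set. -/
def IsCantorSet (K : Set ℝ) : Prop := Nonempty (K ≃ₜ cantorSet)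

/-- The union of the straight segments in the plane from `(0, 0)` to `(c, -1)`, for `c ∈ K`. -/
def fanOver (K : Set ℝ) : Set (ℝ × ℝ) :=
  ⋃ c ∈ K, segment ℝ ((0 : ℝ), (0 : ℝ)) (c, -1)

/-- A space is a Cantor fan if it is homeomorphic to the fan in the plane over some Cantor set
contained in `[0, 1]`. -/
def IsCantorFan (X : Type*) [TopologicalSpace X] : Prop :=
  ∃ K : Set ℝ, K ⊆ Icc 0 1 ∧ IsCantorSet K ∧ Nonempty (X ≃ₜ fanOver K)

/-! ### Mahavier products of a relation and their shifts -/

section Mahavier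

variable {X : Type*} (F : Set (X × X))

/-- The Mahavier product (one-sided sequences, indexed from `0`). -/
def MahavierProduct : Type _ := {x : ℕ → X // ∀ i, (x i, x (i + 1)) ∈ F}

/-- The two-sided Mahavier product. -/
def TwoSidedMahavierProduct : Type _ := {x : ℤ → X // ∀ i, (x i, x (i + 1)) ∈ F}

instance [TopologicalSpace X] : TopologicalSpace (MahavierProduct F) :=
  inferInstanceAs (TopologicalSpace {x : ℕ → X // ∀ i, (x i, x (i + 1)) ∈ F})

instance [TopologicalSpace X] : TopologicalSpace (TwoSidedMahavierProduct F) :=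
  inferInstanceAs (TopologicalSpace {x : ℤ → X // ∀ i, (x i, x (i + 1)) ∈ F})

/-- The shift map on the Mahavier product. -/
def shift (x : MahavierProduct F) : MahavierProduct F :=
  ⟨fun i => x.1 (i + 1), fun i => x.2 (i + 1)⟩

/-- The shift map on the two-sided Mahavier product. -/
def twoSidedShift (x : TwoSidedMahavierProduct F) : TwoSidedMahavierProduct F :=
  ⟨fun i => x.1 (i + 1), fun i => x.2 (i + 1)⟩

variable (A : Set X)

/-- The equivalence relation on the Mahavier product identifying all the points whose coordinates
all lie in `A`. -/
def collapse : Setoid (MahavierProduct F) where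
  r x y := x = y ∨ ∀ k, {x.1 k, y.1 k} ⊆ A
  iseqv := by
    refine ⟨fun x => Or.inl rfl, ?_, ?_⟩
    · rintro x y (h | h)
      · exact Or.inl h.symm
      · exact Or.inr fun k => by rw [pair_comm]; exact h k
    · rintro x y z (rfl | h) (rfl | h')
      · exact Or.inl rfl
      · exact Or.inr h'
      · exact Or.inr h
      · refine Or.inr fun k => ?_
        have h1 := h k
        have h2 := h' k
        rw [pair_subset_iff] at h1 h2 ⊢
        exact ⟨h1.1, h2.2⟩

/-- The same equivalence relation on the two-sided Mahavier product. -/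
def twoSidedCollapse : Setoid (TwoSidedMahavierProduct F) where
  r x y := x = y ∨ ∀ k, {x.1 k, y.1 k} ⊆ A
  iseqv := by
    refine ⟨fun x => Or.inl rfl, ?_, ?_⟩
    · rintro x y (h | h)
      · exact Or.inl h.symm
      · exact Or.inr fun k => by rw [pair_comm]; exact h k
    · rintro x y z (rfl | h) (rfl | h')
      · exact Or.inl rfl
      · exact Or.inr h'
      · exact Or.inr h
      · refine Or.inr fun k => ?_
        have h1 := h k
        have h2 := h' k
        rw [pair_subset_iff] at h1 h2 ⊢
        exact ⟨h1.1, h2.2⟩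

/-- The map `[x] ↦ [σ x]` induced by the shift on the quotient of the Mahavier product. -/
def quotientShift : Quotient (collapse F A) → Quotient (collapse F A) :=
  Quotient.map (shift F) (by
    rintro x y (rfl | h)
    · exact Or.inl rfl
    · exact Or.inr fun k => h (k + 1))

/-- The map `[x] ↦ [σ x]` induced by the shift on the quotient of the two-sided Mahavier
product. -/
def twoSidedQuotientShift :
    Quotient (twoSidedCollapse F A) → Quotient (twoSidedCollapse F A) :=
  Quotient.map (twoSidedShift F) (by
    rintro x y (rfl | h)
    · exact Or.inl rfl
    · exact Or.inr fun k => h (k + 1))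

end Mahavier

/-! ### The relation on four intervals -/

noncomputable section

/-- The set `[0,1] ∪ [2,3] ∪ [4,5] ∪ [6,7]`. -/
def fourIntervals : Set ℝ := Icc 0 1 ∪ Icc 2 3 ∪ Icc 4 5 ∪ Icc 6 7

open Classical in
/-- The formula of `f₁`; its value outside the four intervals is irrelevant. -/
def formulaOne (x : ℝ) : ℝ :=
  if x ∈ Icc (0 : ℝ) 1 then x ^ 2
  else if x ∈ Icc (2 : ℝ) 3 then (x - 2) ^ (1 / 2 : ℝ) + 2
  else if x ∈ Icc (4 : ℝ) 5 then (x - 4) ^ 3 + 4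
  else (x - 6) ^ (1 / 3 : ℝ) + 6

open Classical in
/-- The formula of `f₂`; its value outside the four intervals is irrelevant. -/
def formulaTwo (x : ℝ) : ℝ :=
  if x ∈ Icc (0 : ℝ) 1 ∪ Icc 4 5 then x + 2 else x - 2

open Classical in
/-- The formula of `f₃`; its value outside the four intervals is irrelevant. -/
def formulaThree (x : ℝ) : ℝ :=
  if x ∈ Icc (0 : ℝ) 1 then x ^ 2
  else if x ∈ Icc (2 : ℝ) 3 then x + 2
  else if x ∈ Icc (4 : ℝ) 5 then x - 2
  else (x - 6) ^ (1 / 3 : ℝ) + 6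

theorem rpow_mem_unit {x a : ℝ} (h0 : 0 ≤ x) (h1 : x ≤ 1) (ha : 0 ≤ a) :
    0 ≤ x ^ a ∧ x ^ a ≤ 1 :=
  ⟨Real.rpow_nonneg h0 a, Real.rpow_le_one h0 h1 ha⟩

theorem mapsTo_formulaOne : MapsTo formulaOne fourIntervals fourIntervals := by
  intro x hx
  have hc : x ∈ Icc (0 : ℝ) 1 ∨ x ∈ Icc (2 : ℝ) 3 ∨ x ∈ Icc (4 : ℝ) 5 ∨ x ∈ Icc (6 : ℝ) 7 := by
    simpa [fourIntervals, or_assoc] using hx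
  unfold formulaOne
  split_ifs with h1 h2 h3
  · exact Or.inl (Or.inl (Or.inl ⟨by positivity, pow_le_one₀ h1.1 h1.2⟩))
  · have := rpow_mem_unit (x := x - 2) (a := 1 / 2) (by linarith [h2.1]) (by linarith [h2.2])
      (by norm_num)
    exact Or.inl (Or.inl (Or.inr ⟨by linarith [this.1], by linarith [this.2]⟩))
  · have a : 0 ≤ (x - 4) ^ 3 := pow_nonneg (by linarith [h3.1]) 3
    have b : (x - 4) ^ 3 ≤ 1 := pow_le_one₀ (by linarith [h3.1]) (by linarith [h3.2])
    exact Or.inl (Or.inr ⟨by linarith, by linarith⟩)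
  · have h4 : x ∈ Icc (6 : ℝ) 7 := by tauto
    have := rpow_mem_unit (x := x - 6) (a := 1 / 3) (by linarith [h4.1]) (by linarith [h4.2])
      (by norm_num)
    exact Or.inr ⟨by linarith [this.1], by linarith [this.2]⟩

theorem mapsTo_formulaTwo : MapsTo formulaTwo fourIntervals fourIntervals := by
  intro x hx
  have hc : x ∈ Icc (0 : ℝ) 1 ∨ x ∈ Icc (2 : ℝ) 3 ∨ x ∈ Icc (4 : ℝ) 5 ∨ x ∈ Icc (6 : ℝ) 7 := by
    simpa [fourIntervals, or_assoc] using hx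
  unfold formulaTwo
  split_ifs with h
  · rcases h with h | h
    · exact Or.inl (Or.inl (Or.inr ⟨by linarith [h.1], by linarith [h.2]⟩))
    · exact Or.inr ⟨by linarith [h.1], by linarith [h.2]⟩
  · have h' : x ∈ Icc (2 : ℝ) 3 ∨ x ∈ Icc (6 : ℝ) 7 := by
      rw [mem_union] at h
      tauto
    rcases h' with h' | h'
    · exact Or.inl (Or.inl (Or.inl ⟨by linarith [h'.1], by linarith [h'.2]⟩))
    · exact Or.inl (Or.inr ⟨by linarith [h'.1], by linarith [h'.2]⟩)

theorem mapsTo_formulaThree : MapsTo formulaThree fourIntervals fourIntervals := by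
  intro x hx
  have hc : x ∈ Icc (0 : ℝ) 1 ∨ x ∈ Icc (2 : ℝ) 3 ∨ x ∈ Icc (4 : ℝ) 5 ∨ x ∈ Icc (6 : ℝ) 7 := by
    simpa [fourIntervals, or_assoc] using hx
  unfold formulaThree
  split_ifs with h1 h2 h3
  · exact Or.inl (Or.inl (Or.inl ⟨by positivity, pow_le_one₀ h1.1 h1.2⟩))
  · exact Or.inl (Or.inr ⟨by linarith [h2.1], by linarith [h2.2]⟩)
  · exact Or.inl (Or.inl (Or.inr ⟨by linarith [h3.1], by linarith [h3.2]⟩))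
  · have h4 : x ∈ Icc (6 : ℝ) 7 := by tauto
    have := rpow_mem_unit (x := x - 6) (a := 1 / 3) (by linarith [h4.1]) (by linarith [h4.2])
      (by norm_num)
    exact Or.inr ⟨by linarith [this.1], by linarith [this.2]⟩

/-- The map `f₁` from the four intervals to themselves. -/
def fOne : fourIntervals → fourIntervals := mapsTo_formulaOne.restrict

/-- The map `f₂` from the four intervals to themselves. -/
def fTwo : fourIntervals → fourIntervals := mapsTo_formulaTwo.restrict

/-- The map `f₃` from the four intervals to themselves. -/
def fThree : fourIntervals → fourIntervals := mapsTo_formulaThree.restrict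

/-- The relation `F`, the union of the graphs of `f₁`, `f₂` and `f₃`. -/
def relF : Set (fourIntervals × fourIntervals) :=
  {p | p.2 = fOne p.1} ∪ {p | p.2 = fTwo p.1} ∪ {p | p.2 = fThree p.1}

/-- The set `{0, 2, 4, 6}` as a subset of the four intervals. -/
def bottomPoints : Set fourIntervals := {x | (x : ℝ) ∈ ({0, 2, 4, 6} : Set ℝ)}

end

end CantorFanChaos

namespace CantorFanChaos

open Set Topology NNReal

/-! ### A characterisation of the Cantor space -/

section CantorSpace

variable {X : Type*}

/-! Write a point of the four intervals as `(v, t)`, with `v` the number of the interval and `t` its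
height in the unit interval. Then `F` allows a step from `(v, s)` to `(w, t)` exactly when `v`, `w`
are equal or adjacent in the path 0 - 1 - 2 - 3 and `t = s ^ weight v w`, where the loops have
weights 2, 1/2, 3, 1/3 and all other edges weight 1 (`chart_mem_relF`). Hence a sequence in the
Mahavier product amounts to a walk on this graph together with its height at index 0
(`ExponentCocycle.homeomorph`). The walks form a Cantor set (`nonempty_itinerary_homeomorph`), so
the product is a Cantor set times an interval. The sequences lying in {0, 2, 4, 6} are those of
height 0; collapsing them gives a cone over a Cantor set, that is, a Cantor fan
(`nonempty_quotient_homeomorph`). In these coordinates the shift moves the walk and raises the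
height to a power. Between any two vertices there are walks with total exponent any prescribed `2 ^
a * 3 ^ b` (`reach_of_isTwoThree`), and these numbers are dense in the positive reals because log 2
/ log 3 is irrational. Gluing walks with a suitable exponent gives transitivity; gluing a walk to
itself with exponent 1 gives periodic points. Chaos then passes from the two-sided shift to its
factors: the one-sided shift and both quotients. -/

/-- The clopen cell reached from the whole space after `n` binary choices, a cell `D` at stage `n`
being cut by the set `E n D`. -/
def cell (E : ℕ → Set X → Set X) (b : ℕ → Bool) : ℕ → Set X
  | 0 => univ
  | n + 1 => if b n then cell E b n ∩ E n (cell E b n) else cell E b n \ E n (cell E b n)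

open Classical in
/-- The cell of stage `n` containing `x`. -/
def cellAt (E : ℕ → Set X → Set X) (x : X) : ℕ → Set X
  | 0 => univ
  | n + 1 => if x ∈ E n (cellAt E x n) then cellAt E x n ∩ E n (cellAt E x n)
      else cellAt E x n \ E n (cellAt E x n)

open Classical in
/-- The sequence of binary choices leading to `x`. -/
noncomputable def address (E : ℕ → Set X → Set X) (x : X) (n : ℕ) : Bool :=
  decide (x ∈ E n (cellAt E x n))

theorem cellAt_eq_cell (E : ℕ → Set X → Set X) (x : X) (n : ℕ) :
    cellAt E x n = cell E (address E x) n := by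
  induction n with
  | zero => rfl
  | succ n ih =>
    have h : address E x n = true ↔ x ∈ E n (cellAt E x n) := by simp [address]
    rw [cellAt, cell, ← ih]
    by_cases hx : x ∈ E n (cellAt E x n)
    · rw [if_pos hx, if_pos (h.2 hx)]
    · rw [if_neg hx, if_neg (h.not.2 hx)]

theorem mem_cellAt (E : ℕ → Set X → Set X) (x : X) (n : ℕ) : x ∈ cellAt E x n := by
  induction n with
  | zero => trivial
  | succ n ih =>
    rw [cellAt]
    split_ifs with h
    exacts [⟨ih, h⟩, ⟨ih, h⟩]

theorem cell_succ_subset (E : ℕ → Set X → Set X) (b : ℕ → Bool) (n : ℕ) :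
    cell E b (n + 1) ⊆ cell E b n := by
  rw [cell]
  split_ifs
  exacts [inter_subset_left, sdiff_subset]

/-- The cells of one stage are pairwise disjoint, so membership in one of them fixes all earlier
choices. -/
theorem address_of_mem_cell {E : ℕ → Set X → Set X} {b : ℕ → Bool} {x : X} {n : ℕ}
    (hx : x ∈ cell E b n) : cellAt E x n = cell E b n ∧ ∀ k < n, address E x k = b k := by
  induction n with
  | zero => exact ⟨rfl, by simp⟩
  | succ n ih =>
    obtain ⟨h1, h2⟩ := ih (cell_succ_subset E b n hx)
    have key : address E x n = b n := by
      rw [cell] at hx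
      rw [address, h1]
      split_ifs at hx with hb
      · simpa [hb] using hx.2
      · simpa [hb] using hx.2
    refine ⟨?_, fun k hk => ?_⟩
    · rw [cellAt_eq_cell] at h1 ⊢
      simp [cell, h1, key]
    · rcases Nat.lt_succ_iff_lt_or_eq.1 hk with h | rfl
      exacts [h2 k h, key]

theorem isClopen_cell [TopologicalSpace X] [Nonempty X] {E : ℕ → Set X → Set X}
    (hE : ∀ n D, IsClopen D → D.Nonempty →
      IsClopen (E n D) ∧ (D ∩ E n D).Nonempty ∧ (D \ E n D).Nonempty)
    (b : ℕ → Bool) (n : ℕ) : IsClopen (cell E b n) ∧ (cell E b n).Nonempty := by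
  induction n with
  | zero => exact ⟨isClopen_univ, univ_nonempty⟩
  | succ n ih =>
    obtain ⟨h1, h2, h3⟩ := hE n _ ih.1 ih.2
    rw [cell]
    split_ifs
    exacts [⟨ih.1.inter h1, h2⟩, ⟨ih.1.diff h1, h3⟩]

/-- A nonempty compact space with a countable separating family of clopen sets, in which every
nonempty clopen set can be cut into two, is homeomorphic to the Cantor space. -/
theorem nonempty_homeomorph_cantorSpace [TopologicalSpace X] [CompactSpace X] [Nonempty X] (C : ℕ → Set X)
    (hC : ∀ n, IsClopen (C n)) (hsep : ∀ x y, x ≠ y → ∃ n, x ∈ C n ∧ y ∉ C n)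
    (hsplit : ∀ D : Set X, IsClopen D → D.Nonempty →
      ∃ E, IsClopen E ∧ (D ∩ E).Nonempty ∧ (D \ E).Nonempty) :
    Nonempty (X ≃ₜ (ℕ → Bool)) := by
  -- Cut `D` by `C n` whenever that is a proper cut, otherwise by any splitting clopen set. Thus
  -- every cut is proper, and no `C n` fails to separate points that are still together at stage
  -- `n`.
  have hex : ∀ (n : ℕ) (D : Set X), ∃ E : Set X, IsClopen D → D.Nonempty →
      (IsClopen E ∧ (D ∩ E).Nonempty ∧ (D \ E).Nonempty) ∧
      ((D ∩ C n).Nonempty → (D \ C n).Nonempty → E = C n) := by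
    intro n D
    by_cases h : (D ∩ C n).Nonempty ∧ (D \ C n).Nonempty
    · exact ⟨C n, fun _ _ => ⟨⟨hC n, h⟩, fun _ _ => rfl⟩⟩
    · by_cases hD : IsClopen D ∧ D.Nonempty
      · obtain ⟨E, hE⟩ := hsplit D hD.1 hD.2
        exact ⟨E, fun _ _ => ⟨hE, fun h1 h2 => absurd ⟨h1, h2⟩ h⟩⟩
      · exact ⟨∅, fun h1 h2 => absurd ⟨h1, h2⟩ hD⟩
  choose E hE using hex
  have hcell : ∀ b n, IsClopen (cell E b n) ∧ (cell E b n).Nonempty := fun b n =>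
    isClopen_cell (fun n D h1 h2 => (hE n D h1 h2).1) b n
  have hcont : Continuous (address E) := by
    refine continuous_pi fun n => (IsLocallyConstant.iff_eventually_eq _).2 (fun x => ?_) |>.continuous
    filter_upwards [(hcell (address E x) (n + 1)).1.isOpen.mem_nhds
      (by rw [← cellAt_eq_cell]; exact mem_cellAt E x _)] with y hy
    exact (address_of_mem_cell hy).2 n n.lt_succ_self
  have hinj : Function.Injective (address E) := by
    intro x y hxy
    by_contra hne
    obtain ⟨n, hx, hy⟩ := hsep x y hne
    have hcl : cellAt E x n = cellAt E y n := by rw [cellAt_eq_cell, cellAt_eq_cell, hxy]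
    have hEC : E n (cellAt E x n) = C n := by
      obtain ⟨h1, h2⟩ := hcell (address E x) n
      rw [← cellAt_eq_cell] at h1 h2
      exact (hE n _ h1 h2).2 ⟨x, mem_cellAt E x n, hx⟩ ⟨y, hcl ▸ mem_cellAt E y n, hy⟩
    have := congrFun hxy n
    rw [address, address, ← hcl, hEC] at this
    simp [hx, hy] at this
  -- The cells along `b` are nested, nonempty and compact, so some point lies in all of them.
  have hsurj : Function.Surjective (address E) := by
    intro b
    obtain ⟨x, hx⟩ := IsCompact.nonempty_iInter_of_sequence_nonempty_isCompact_isClosed (cell E b)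
      (cell_succ_subset E b) (fun n => (hcell b n).2) (hcell b 0).1.isClosed.isCompact
      (fun n => (hcell b n).1.isClosed)
    rw [mem_iInter] at hx
    exact ⟨x, funext fun n => (address_of_mem_cell (hx (n + 1))).2 n n.lt_succ_self⟩
  exact ⟨hcont.homeoOfEquivCompactToT2 (f := Equiv.ofBijective _ ⟨hinj, hsurj⟩)⟩

end CantorSpace

/-! ### The relation in coordinates -/

/-- Adjacency in the path `0 - 1 - 2 - 3` with a loop at every vertex. -/
abbrev Adj (v w : Fin 4) : Prop := (v : ℕ) ≤ w + 1 ∧ (w : ℕ) ≤ v + 1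

/-- The exponent by which the height changes along an edge. -/
noncomputable def weight (v w : Fin 4) : ℝ≥0 :=
  if v = w then ![2, 2⁻¹, 3, 3⁻¹] v else 1

theorem weight_pos (v w : Fin 4) : 0 < weight v w := by
  rw [weight]
  split_ifs
  · fin_cases v <;> simp
  · exact one_pos

/-- The power map on the unit interval. -/
noncomputable def unitPow (c : ℝ≥0) (t : unitInterval) : unitInterval :=
  ⟨(t : ℝ) ^ (c : ℝ), rpow_mem_unit t.2.1 t.2.2 c.2⟩

theorem unitPow_one (t : unitInterval) : unitPow 1 t = t := by
  ext; simp [unitPow]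

theorem unitPow_unitPow (c d : ℝ≥0) (t : unitInterval) :
    unitPow d (unitPow c t) = unitPow (c * d) t := by
  ext; simp [unitPow, Real.rpow_mul t.2.1]

theorem unitPow_injective {c : ℝ≥0} (hc : 0 < c) : Function.Injective (unitPow c) := by
  intro s t h
  have := congrArg (unitPow c⁻¹) h
  rwa [unitPow_unitPow, unitPow_unitPow, mul_inv_cancel₀ hc.ne', unitPow_one, unitPow_one] at this

theorem unitPow_zero {c : ℝ≥0} (hc : 0 < c) : unitPow c 0 = 0 := by
  ext; simp [unitPow, hc.ne']

theorem unitPow_eq_zero {c : ℝ≥0} (hc : 0 < c) {t : unitInterval} : unitPow c t = 0 ↔ t = 0 := by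
  constructor
  · intro h
    exact unitPow_injective hc (h.trans (unitPow_zero hc).symm)
  · rintro rfl
    exact unitPow_zero hc

theorem chart_mem (p : Fin 4 × unitInterval) : 2 * ((p.1 : ℕ) : ℝ) + p.2 ∈ fourIntervals := by
  obtain ⟨v, t, h0, h1⟩ := p
  fin_cases v <;> simp only [fourIntervals, mem_union, mem_Icc]
  · exact Or.inl (Or.inl (Or.inl ⟨by norm_num; linarith, by norm_num; linarith⟩))
  · exact Or.inl (Or.inl (Or.inr ⟨by norm_num; linarith, by norm_num; linarith⟩))
  · exact Or.inl (Or.inr ⟨by norm_num; linarith, by norm_num; linarith⟩)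
  · exact Or.inr ⟨by norm_num; linarith, by norm_num; linarith⟩

/-- The point of height `t` on the interval number `v`. -/
def chartFun (p : Fin 4 × unitInterval) : fourIntervals :=
  ⟨2 * ((p.1 : ℕ) : ℝ) + p.2, chart_mem p⟩

theorem continuous_chartFun : Continuous chartFun := by
  refine Continuous.subtype_mk ?_ _
  have : Continuous fun v : Fin 4 => 2 * ((v : ℕ) : ℝ) := continuous_of_discreteTopology
  exact (this.comp continuous_fst).add (continuous_subtype_val.comp continuous_snd)

theorem chartFun_bijective : Function.Bijective chartFun := by
  constructor
  · rintro ⟨v, s, hs0, hs1⟩ ⟨w, t, ht0, ht1⟩ h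
    have h : 2 * ((v : ℕ) : ℝ) + s = 2 * ((w : ℕ) : ℝ) + t := congrArg Subtype.val h
    have hvw : v = w := by
      apply Fin.ext
      by_contra hne
      rcases Nat.lt_or_gt_of_ne hne with hlt | hlt
      · have : ((v : ℕ) : ℝ) + 1 ≤ (w : ℕ) := by exact_mod_cast hlt
        linarith
      · have : ((w : ℕ) : ℝ) + 1 ≤ (v : ℕ) := by exact_mod_cast hlt
        linarith
    subst hvw
    have : s = t := by linarith
    subst this
    rfl
  · rintro ⟨x, ((hx | hx) | hx) | hx⟩
    · exact ⟨(0, ⟨x, hx⟩), Subtype.ext (by simp [chartFun])⟩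
    · exact ⟨(1, ⟨x - 2, by linarith [hx.1], by linarith [hx.2]⟩),
        Subtype.ext (by simp [chartFun])⟩
    · exact ⟨(2, ⟨x - 4, by linarith [hx.1], by linarith [hx.2]⟩),
        Subtype.ext (by simp [chartFun]; norm_num)⟩
    · exact ⟨(3, ⟨x - 6, by linarith [hx.1], by linarith [hx.2]⟩),
        Subtype.ext (by simp [chartFun]; norm_num)⟩

/-- Points of the four intervals as pairs: the number of the interval and the height. -/
noncomputable def chart : Fin 4 × unitInterval ≃ₜ fourIntervals :=
  continuous_chartFun.homeoOfEquivCompactToT2 (f := Equiv.ofBijective _ chartFun_bijective)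

theorem coe_chart (v : Fin 4) (t : unitInterval) :
    (chart (v, t) : ℝ) = 2 * ((v : ℕ) : ℝ) + t := rfl

theorem fOne_chart (v : Fin 4) (t : unitInterval) :
    fOne (chart (v, t)) = chart (v, unitPow (weight v v) t) := by
  obtain ⟨t, h0, h1⟩ := t
  apply Subtype.ext
  change formulaOne _ = _
  simp only [coe_chart, unitPow, formulaOne, mem_Icc, weight]
  fin_cases v
  · norm_num [h0, h1]
  · norm_num [h0, h1]
    rw [if_neg (by intro; linarith), if_pos (by linarith)]
    ring
  · norm_num [h0, h1]
    rw [if_neg (by intro; linarith), if_neg (by intro; linarith), if_pos (by linarith)]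
    ring
  · norm_num [h0, h1]
    rw [if_neg (by intro; linarith), if_neg (by intro; linarith), if_neg (by intro; linarith)]
    ring

theorem fTwo_chart (v : Fin 4) (t : unitInterval) :
    fTwo (chart (v, t)) = chart (![1, 0, 3, 2] v, t) := by
  obtain ⟨t, h0, h1⟩ := t
  apply Subtype.ext
  change formulaTwo _ = _
  simp only [coe_chart, formulaTwo, mem_Icc, mem_union]
  fin_cases v
  · norm_num [h0, h1]
    ring
  · norm_num [h0, h1]
    intro h
    rcases h with h | h <;> linarith
  · norm_num [h0, h1]
    rw [if_pos (by right; linarith)]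
    ring
  · norm_num [h0, h1]
    rw [if_neg (by rintro (h | h) <;> linarith)]
    ring

theorem fThree_chart (v : Fin 4) (t : unitInterval) :
    fThree (chart (v, t)) = chart (![0, 2, 1, 3] v, unitPow (![2, 1, 1, 3⁻¹] v) t) := by
  obtain ⟨t, h0, h1⟩ := t
  apply Subtype.ext
  change formulaThree _ = _
  simp only [coe_chart, unitPow, formulaThree, mem_Icc]
  fin_cases v
  · norm_num [h0, h1]
  · norm_num [h0, h1]
    rw [if_neg (by intro; linarith), if_pos (by linarith)]
    ring
  · norm_num [h0, h1]
    rw [if_neg (by intro; linarith), if_neg (by intro; linarith), if_pos (by linarith)]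
    ring
  · norm_num [h0, h1]
    rw [if_neg (by intro; linarith), if_neg (by intro; linarith), if_neg (by intro; linarith)]
    ring

/-- `fOne` supplies the four loops, `fTwo` the edges 0 - 1 and 2 - 3, `fThree` the edge 1 - 2; the
loops of `fThree` at 0 and 3 coincide with those of `fOne`. -/
theorem chart_mem_relF (v w : Fin 4) (s t : unitInterval) :
    (chart (v, s), chart (w, t)) ∈ relF ↔ Adj v w ∧ t = unitPow (weight v w) s := by
  simp only [relF, mem_union, mem_ofPred_eq, fOne_chart, fTwo_chart, fThree_chart,
    chart.injective.eq_iff, Prod.mk.injEq]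
  fin_cases v <;> fin_cases w <;> simp [weight, unitPow_one, Adj]

theorem chart_mem_bottomPoints (v : Fin 4) (t : unitInterval) :
    chart (v, t) ∈ bottomPoints ↔ t = 0 := by
  obtain ⟨t, h0, h1⟩ := t
  simp only [bottomPoints, mem_ofPred_eq, coe_chart, mem_insert_iff, mem_singleton_iff,
    Subtype.ext_iff, Icc.coe_zero]
  constructor
  · intro h
    fin_cases v <;> norm_num at h <;> rcases h with h | h | h | h <;> linarith
  · rintro rfl
    fin_cases v <;> norm_num

theorem mem_relF_iff (x y : fourIntervals) :
    (x, y) ∈ relF ↔ Adj (chart.symm x).1 (chart.symm y).1 ∧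
      (chart.symm y).2 = unitPow (weight (chart.symm x).1 (chart.symm y).1) (chart.symm x).2 := by
  obtain ⟨⟨v, s⟩, rfl⟩ := chart.surjective x
  obtain ⟨⟨w, t⟩, rfl⟩ := chart.surjective y
  simp only [chart_mem_relF, Homeomorph.symm_apply_apply]

/-! ### Itineraries -/

/-- The space of `ι`-indexed walks on the graph given by `Adj`. -/
abbrev Itinerary (ι : Type*) [Add ι] [One ι] : Type _ :=
  {i : ι → Fin 4 // ∀ k, Adj (i k) (i (k + 1))}

instance compactSpace_itinerary (ι : Type*) [Add ι] [One ι] : CompactSpace (Itinerary ι) := by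
  refine isCompact_iff_compactSpace.1 (IsClosed.isCompact
    (s := {i : ι → Fin 4 | ∀ k, Adj (i k) (i (k + 1))}) ?_)
  rw [ofPred_forall]
  refine isClosed_iInter fun k => ?_
  have h : IsClosed {p : Fin 4 × Fin 4 | Adj p.1 p.2} := isClosed_discrete _
  have hf : Continuous fun i : ι → Fin 4 => (i k, i (k + 1)) := by fun_prop
  exact h.preimage hf

theorem continuous_itinerary_apply {ι : Type*} [Add ι] [One ι] (k : ι) :
    Continuous fun i : Itinerary ι => i.1 k :=
  (continuous_apply k).comp continuous_subtype_val

/-- A neighbourhood of an itinerary contains all itineraries that agree with it on some finite set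
of indices. -/
theorem exists_finset_of_mem_nhds {ι : Type*} [Add ι] [One ι] {i : Itinerary ι}
    {U : Set (Itinerary ι)} (hU : U ∈ 𝓝 i) :
    ∃ s : Finset ι, ∀ j : Itinerary ι, (∀ k ∈ s, j.1 k = i.1 k) → j ∈ U := by
  rw [nhds_subtype_eq_comap, Filter.mem_comap] at hU
  obtain ⟨V, hV, hVU⟩ := hU
  rw [nhds_pi, Filter.mem_pi'] at hV
  obtain ⟨s, t, ht, hst⟩ := hV
  refine ⟨s, fun j hj => hVU (hst fun k hk => ?_)⟩
  rw [hj k hk]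
  exact mem_of_mem_nhds (ht k)

/-- Every vertex offers at least two continuations; this is why the space of walks has no isolated
points. -/
theorem exists_adj_ne (v w : Fin 4) : ∃ u, Adj v u ∧ u ≠ w := by
  revert v w
  decide

theorem exists_itinerary_ne {ι : Type*} [LinearOrder ι] [Add ι] [One ι] [SuccAddOrder ι]
    [NoMaxOrder ι] (i : Itinerary ι) (N : ι) : ∃ j : Itinerary ι, j ≠ i ∧ ∀ k ≤ N, j.1 k = i.1 k := by
  obtain ⟨u, hu, hne⟩ := exists_adj_ne (i.1 N) (i.1 (N + 1))
  have hlt : ∀ k : ι, k < k + 1 := fun k => Order.succ_eq_add_one k ▸ Order.lt_succ k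
  have hN : ¬ N + 1 ≤ N := not_le.2 (hlt N)
  refine ⟨⟨fun k => if k ≤ N then i.1 k else u, fun k => ?_⟩, fun h => ?_, fun k hk => if_pos hk⟩
  · beta_reduce
    by_cases h1 : k + 1 ≤ N
    · rw [if_pos h1, if_pos ((hlt k).le.trans h1)]
      exact i.2 k
    · rw [if_neg h1]
      split_ifs with h2
      · have : k = N := le_antisymm h2 (Order.lt_add_one_iff.1 (not_le.1 h1))
        rwa [this]
      · exact ⟨by omega, by omega⟩
  · have := congrArg (fun j : Itinerary ι => j.1 (N + 1)) h
    simp only [if_neg hN] at this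
    exact hne this

/-- Itinerary spaces are Cantor sets. -/
theorem nonempty_itinerary_homeomorph (ι : Type*) [LinearOrder ι] [Add ι] [One ι] [SuccAddOrder ι]
    [NoMaxOrder ι] [Countable ι] [Nonempty ι] : Nonempty (Itinerary ι ≃ₜ cantorSet) := by
  have : Nonempty (Itinerary ι) := ⟨⟨fun _ => 0, fun _ => ⟨zero_le_one, zero_le_one⟩⟩⟩
  obtain ⟨f, hf⟩ := exists_surjective_nat (ι × Fin 4)
  have hclopen : ∀ (k : ι) (v : Fin 4), IsClopen {i : Itinerary ι | i.1 k = v} := fun k v =>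
    (isClopen_discrete {v}).preimage (continuous_itinerary_apply k)
  obtain ⟨e⟩ := nonempty_homeomorph_cantorSpace
    (fun n => {i : Itinerary ι | i.1 (f n).1 = (f n).2}) (fun n => hclopen _ _) (by
      intro i j hij
      obtain ⟨k, hk⟩ : ∃ k, i.1 k ≠ j.1 k := by
        by_contra! h
        exact hij (Subtype.ext (funext h))
      obtain ⟨n, hn⟩ := hf (k, i.1 k)
      exact ⟨n, by simp [hn], by simpa [hn] using hk.symm⟩) (by
      rintro D hD ⟨i, hi⟩
      obtain ⟨s, hs⟩ := exists_finset_of_mem_nhds (hD.isOpen.mem_nhds hi)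
      obtain ⟨N, hN⟩ := s.exists_le
      obtain ⟨j, hji, hj⟩ := exists_itinerary_ne i N
      obtain ⟨k, hk⟩ : ∃ k, j.1 k ≠ i.1 k := by
        by_contra! h
        exact hji (Subtype.ext (funext h))
      exact ⟨{l | l.1 k = i.1 k}, hclopen _ _, ⟨i, hi, rfl⟩,
        ⟨j, hs j fun k hk => hj k (hN k hk), hk⟩⟩)
  exact ⟨e.trans cantorSetHomeomorphNatToBool.symm⟩

/-! ### Exponents along itineraries and coordinates on the Mahavier products -/

/-- The exponents relating the height of a point of the Mahavier product at each index to its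
height at index `0`. -/
structure ExponentCocycle (ι : Type*) [Add ι] [One ι] [Zero ι] where
  toFun : ι → Itinerary ι → ℝ≥0
  zero : ∀ i, toFun 0 i = 1
  add_one : ∀ k i, toFun (k + 1) i = toFun k i * weight (i.1 k) (i.1 (k + 1))
  continuous : ∀ k, Continuous (toFun k)
  pos : ∀ k i, 0 < toFun k i
  -- An equivalence, not an implication, so that the principle holds on `ℤ` as well as on `ℕ`.
  induction : ∀ S : ι → Prop, S 0 → (∀ k, S k ↔ S (k + 1)) → ∀ k, S k

theorem continuous_weight {ι : Type*} [Add ι] [One ι] (k : ι) :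
    Continuous fun i : Itinerary ι => weight (i.1 k) (i.1 (k + 1)) :=
  (continuous_of_discreteTopology (f := fun p : Fin 4 × Fin 4 => weight p.1 p.2)).comp
    ((continuous_itinerary_apply k).prodMk (continuous_itinerary_apply (k + 1)))

/-- The exponents for one-sided sequences. -/
noncomputable def natCocycle : ExponentCocycle ℕ where
  toFun n i := ∏ k ∈ Finset.range n, weight (i.1 k) (i.1 (k + 1))
  zero i := by simp
  add_one k i := Finset.prod_range_succ _ _
  continuous n := continuous_finsetProd _ fun k _ => continuous_weight k
  pos n i := Finset.prod_pos fun _ _ => weight_pos _ _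
  induction S h0 h k := by
    induction k with
    | zero => exact h0
    | succ k ih => exact (h k).1 ih

/-- The exponents for two-sided sequences. -/
noncomputable def intCocycle : ExponentCocycle ℤ where
  -- At most one of the two products is nonempty: the numerator for positive `n`, the denominator
  -- for negative `n`.
  toFun n i := (∏ k ∈ Finset.Ico 0 n, weight (i.1 k) (i.1 (k + 1))) /
    ∏ k ∈ Finset.Ico n 0, weight (i.1 k) (i.1 (k + 1))
  zero i := by simp
  add_one n i := by
    rcases le_or_gt 0 n with h | h
    · rw [Finset.Ico_eq_empty_of_le h, Finset.Ico_eq_empty_of_le (by omega : (0 : ℤ) ≤ n + 1),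
        Finset.prod_empty, div_one, div_one, ← Finset.insert_Ico_right_eq_Ico_add_one h,
        Finset.prod_insert (by simp), mul_comm]
    · rw [Finset.Ico_eq_empty_of_le h.le, Finset.Ico_eq_empty_of_le (by omega : n + 1 ≤ 0),
        Finset.prod_empty, ← Finset.insert_Ico_add_one_left_eq_Ico h,
        Finset.prod_insert (by simp), one_div, one_div, mul_inv, mul_right_comm,
        inv_mul_cancel₀ (weight_pos _ _).ne', one_mul]
  continuous n := (continuous_finsetProd _ fun k _ => continuous_weight k).div₀
    (continuous_finsetProd _ fun k _ => continuous_weight k)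
    fun i => (Finset.prod_pos fun _ _ => weight_pos _ _).ne'
  pos n i := div_pos (Finset.prod_pos fun _ _ => weight_pos _ _)
    (Finset.prod_pos fun _ _ => weight_pos _ _)
  induction S h0 h k := by
    induction k with
    | zero => exact h0
    | succ k ih => exact (h k).1 ih
    | pred k ih => exact (h _).2 (by simpa using ih)

/-- Positivity of the exponent excludes the discontinuity of `x ^ y` at (0, 0). -/
theorem continuous_unitPow {Y : Type*} [TopologicalSpace Y] {c : Y → ℝ≥0} {t : Y → unitInterval}
    (hc : Continuous c) (ht : Continuous t) (hpos : ∀ y, 0 < c y) :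
    Continuous fun y => unitPow (c y) (t y) :=
  Continuous.subtype_mk ((continuous_subtype_val.comp ht).rpow
    (NNReal.continuous_coe.comp hc) fun y => Or.inr (hpos y)) _

/-- Sequences compatible with `relF` are given by an itinerary and the height at index `0`. -/
noncomputable def ExponentCocycle.homeomorph {ι : Type*} [Add ι] [One ι] [Zero ι]
    (P : ExponentCocycle ι) :
    Itinerary ι × unitInterval ≃ₜ {x : ι → fourIntervals // ∀ k, (x k, x (k + 1)) ∈ relF} where
  toFun p := ⟨fun k => chart (p.1.1 k, unitPow (P.toFun k p.1) p.2), fun k => by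
    rw [chart_mem_relF, P.add_one, unitPow_unitPow]
    exact ⟨p.1.2 k, rfl⟩⟩
  invFun x := (⟨fun k => (chart.symm (x.1 k)).1, fun k => ((mem_relF_iff _ _).1 (x.2 k)).1⟩,
    (chart.symm (x.1 0)).2)
  left_inv p := by
    simp only [Homeomorph.symm_apply_apply, P.zero, unitPow_one]
  right_inv x := by
    apply Subtype.ext
    funext k
    rw [← chart.symm.injective.eq_iff, Homeomorph.symm_apply_apply]
    refine Prod.ext rfl ?_
    refine P.induction (fun k => unitPow (P.toFun k ⟨fun k => (chart.symm (x.1 k)).1, _⟩)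
      (chart.symm (x.1 0)).2 = (chart.symm (x.1 k)).2) ?_ (fun k => ?_) k
    · rw [P.zero, unitPow_one]
    · rw [P.add_one, ← unitPow_unitPow, ((mem_relF_iff _ _).1 (x.2 k)).2]
      exact (unitPow_injective (weight_pos _ _)).eq_iff.symm
  continuous_toFun := by
    refine Continuous.subtype_mk (continuous_pi fun k => chart.continuous.comp ?_) _
    exact ((continuous_itinerary_apply k).comp continuous_fst).prodMk
      (continuous_unitPow ((P.continuous k).comp continuous_fst) continuous_snd
        fun p => P.pos k p.1)
  continuous_invFun := by
    have h : ∀ k, Continuous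
        fun x : {x : ι → fourIntervals // ∀ k, (x k, x (k + 1)) ∈ relF} => chart.symm (x.1 k) :=
      fun k => chart.symm.continuous.comp ((continuous_apply k).comp continuous_subtype_val)
    exact (Continuous.subtype_mk (continuous_pi fun k => continuous_fst.comp (h k)) _).prodMk
      (continuous_snd.comp (h 0))

theorem ExponentCocycle.homeomorph_apply {ι : Type*} [Add ι] [One ι] [Zero ι]
    (P : ExponentCocycle ι) (i : Itinerary ι) (t : unitInterval) (k : ι) :
    (P.homeomorph (i, t)).1 k = chart (i.1 k, unitPow (P.toFun k i) t) := rfl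

theorem ExponentCocycle.forall_mem_bottomPoints {ι : Type*} [Add ι] [One ι] [Zero ι]
    (P : ExponentCocycle ι) (x : {x : ι → fourIntervals // ∀ k, (x k, x (k + 1)) ∈ relF}) :
    (∀ k, x.1 k ∈ bottomPoints) ↔ (P.homeomorph.symm x).2 = 0 := by
  obtain ⟨⟨i, t⟩, rfl⟩ := P.homeomorph.surjective x
  rw [Homeomorph.symm_apply_apply]
  simp only [ExponentCocycle.homeomorph_apply, chart_mem_bottomPoints, unitPow_eq_zero (P.pos _ _)]
  exact ⟨fun h => h 0, fun h _ => h⟩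

/-! ### Cones over Cantor sets -/

/-- The product of a Cantor set with the unit interval, with the bottom collapsed to a point, is a
Cantor fan, whatever the Cantor set. -/
theorem nonempty_quotient_homeomorph {S Y C : Type*} [TopologicalSpace S] [CompactSpace S]
    [TopologicalSpace Y] [TopologicalSpace C] (e : S × unitInterval ≃ₜ Y)
    (g : S ≃ₜ cantorSet) (r : Setoid Y)
    (hr : ∀ x y, r x y ↔ x = y ∨ ((e.symm x).2 = 0 ∧ (e.symm y).2 = 0)) (hC : IsCantorFan C) :
    Nonempty (Quotient r ≃ₜ C) := by
  obtain ⟨K, -, ⟨k⟩, ⟨c⟩⟩ := hC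
  -- Both `S` and `K` are Cantor sets, so the segments of the fan can be indexed by `S`.
  let m : S → K := fun s => k.symm (g s)
  have hm : Continuous m := k.symm.continuous.comp g.continuous
  have hmem : ∀ p : S × unitInterval, (((p.2 : ℝ) * m p.1, -(p.2 : ℝ)) : ℝ × ℝ) ∈ fanOver K := by
    intro p
    refine mem_biUnion (m p.1).2 ?_
    rw [segment_eq_image]
    exact ⟨p.2, p.2.2, by simp⟩
  let F : S × unitInterval → fanOver K := fun p => ⟨(p.2 * m p.1, -p.2), hmem p⟩
  have hF : Continuous F := by
    refine Continuous.subtype_mk ?_ _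
    have h1 : Continuous fun p : S × unitInterval => (p.2 : ℝ) :=
      continuous_subtype_val.comp continuous_snd
    exact (h1.mul (continuous_subtype_val.comp (hm.comp continuous_fst))).prodMk h1.neg
  have hFsurj : Function.Surjective F := by
    rintro ⟨p, hp⟩
    obtain ⟨a, ha, hpa⟩ := mem_iUnion₂.1 hp
    rw [segment_eq_image] at hpa
    obtain ⟨t, ht, rfl⟩ := hpa
    refine ⟨(g.symm (k ⟨a, ha⟩), ⟨t, ht⟩), Subtype.ext ?_⟩
    simp [F, m]
  have hFker : ∀ p q, F p = F q ↔ p = q ∨ (p.2 = 0 ∧ q.2 = 0) := by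
    rintro ⟨s, t⟩ ⟨s', t'⟩
    constructor
    · intro h
      have h := congrArg Subtype.val h
      simp only [F, Prod.mk.injEq, neg_inj] at h
      obtain ⟨h1, h2⟩ := h
      obtain rfl : t = t' := Subtype.ext h2
      by_cases ht : t = 0
      · exact Or.inr ⟨ht, ht⟩
      · left
        have ht' : (t : ℝ) ≠ 0 := fun h => ht (Subtype.ext h)
        have := g.injective (k.symm.injective (Subtype.ext (mul_left_cancel₀ ht' h1)))
        rw [this]
    · rintro (h | ⟨h, h'⟩)
      · rw [h]
      · obtain rfl : t = 0 := h
        obtain rfl : t' = 0 := h'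
        simp [F]
  have : CompactSpace Y := e.compactSpace
  have hlift : ∀ x y, r x y ↔ F (e.symm x) = F (e.symm y) := fun x y => by
    rw [hr, hFker, e.symm.injective.eq_iff]
  let Φ : Quotient r → fanOver K :=
    Quotient.lift (fun x => F (e.symm x)) fun x y h => (hlift x y).1 h
  have hΦ : Continuous Φ := (hF.comp e.symm.continuous).quotient_lift _
  have hbij : Function.Bijective Φ := by
    constructor
    · rintro ⟨x⟩ ⟨y⟩ h
      exact Quotient.sound ((hlift x y).2 h)
    · intro z
      obtain ⟨p, rfl⟩ := hFsurj z
      exact ⟨Quotient.mk r (e p), by simp [Φ]⟩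
  exact ⟨(hΦ.homeoOfEquivCompactToT2 (f := Equiv.ofBijective _ hbij)).trans c.symm⟩

/-- A setoid identifying the points with all coordinates in the bottom is given by the height. -/
theorem ExponentCocycle.collapse_iff {ι : Type*} [Add ι] [One ι] [Zero ι]
    (P : ExponentCocycle ι) (x y : {x : ι → fourIntervals // ∀ k, (x k, x (k + 1)) ∈ relF}) :
    (x = y ∨ ∀ k, {x.1 k, y.1 k} ⊆ bottomPoints) ↔
      x = y ∨ ((P.homeomorph.symm x).2 = 0 ∧ (P.homeomorph.symm y).2 = 0) := by
  rw [← P.forall_mem_bottomPoints, ← P.forall_mem_bottomPoints, ← forall_and]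
  simp only [pair_subset_iff]

theorem nonempty_collapse_homeomorph {C : Type*} [TopologicalSpace C] (hC : IsCantorFan C) :
    Nonempty (Quotient (collapse relF bottomPoints) ≃ₜ C) := by
  obtain ⟨g⟩ := nonempty_itinerary_homeomorph ℕ
  exact nonempty_quotient_homeomorph (Y := MahavierProduct relF) natCocycle.homeomorph g _
    natCocycle.collapse_iff hC

theorem nonempty_twoSidedCollapse_homeomorph {C : Type*} [TopologicalSpace C]
    (hC : IsCantorFan C) : Nonempty (Quotient (twoSidedCollapse relF bottomPoints) ≃ₜ C) := by
  obtain ⟨g⟩ := nonempty_itinerary_homeomorph ℤ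
  exact nonempty_quotient_homeomorph (Y := TwoSidedMahavierProduct relF) intCocycle.homeomorph g _
    intCocycle.collapse_iff hC

/-! ### Walks with prescribed weight -/

/-- The numbers of the form `2 ^ a * 3 ^ b` with integers `a` and `b`. -/
def IsTwoThree (q : ℝ≥0) : Prop := ∃ a b : ℤ, q = 2 ^ a * 3 ^ b

theorem IsTwoThree.one : IsTwoThree 1 := ⟨0, 0, by simp⟩

theorem IsTwoThree.mul {q r : ℝ≥0} (hq : IsTwoThree q) (hr : IsTwoThree r) :
    IsTwoThree (q * r) := by
  obtain ⟨a, b, rfl⟩ := hq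
  obtain ⟨c, d, rfl⟩ := hr
  exact ⟨a + c, b + d, by rw [zpow_add₀ two_ne_zero, zpow_add₀ three_ne_zero]; ring⟩

theorem IsTwoThree.inv {q : ℝ≥0} (hq : IsTwoThree q) : IsTwoThree q⁻¹ := by
  obtain ⟨a, b, rfl⟩ := hq
  exact ⟨-a, -b, by rw [zpow_neg, zpow_neg, mul_inv]⟩

theorem isTwoThree_weight (v w : Fin 4) : IsTwoThree (weight v w) := by
  rw [weight]
  split_ifs
  · fin_cases v
    · exact ⟨1, 0, by simp⟩
    · exact ⟨-1, 0, by simp⟩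
    · exact ⟨0, 1, by simp⟩
    · exact ⟨0, -1, by simp⟩
  · exact .one

/-- There is a walk from `v` to `w` with the product of the weights equal to `q`. -/
def Reach (v w : Fin 4) (q : ℝ≥0) : Prop :=
  ∃ (n : ℕ) (p : ℕ → Fin 4), p 0 = v ∧ p n = w ∧ (∀ k < n, Adj (p k) (p (k + 1))) ∧
    ∏ k ∈ Finset.range n, weight (p k) (p (k + 1)) = q

theorem Reach.refl (v : Fin 4) : Reach v v 1 := ⟨0, fun _ => v, rfl, rfl, by simp, by simp⟩

theorem Reach.edge {v w : Fin 4} (h : Adj v w) : Reach v w (weight v w) :=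
  ⟨1, fun k => if k = 0 then v else w, by simp, by simp, by simpa using h, by simp⟩

theorem Reach.trans {u v w : Fin 4} {q r : ℝ≥0} (h : Reach u v q) (h' : Reach v w r) :
    Reach u w (q * r) := by
  obtain ⟨n, p, h0, hn, hp, hq⟩ := h
  obtain ⟨m, p', h0', hm, hp', hr⟩ := h'
  have hlow : ∀ k ≤ n, (if k ≤ n then p k else p' (k - n)) = p k := fun k hk => if_pos hk
  have hhigh : ∀ k, (if n + k ≤ n then p (n + k) else p' (n + k - n)) = p' k := by
    intro k
    split_ifs with h
    · obtain rfl : k = 0 := by omega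
      rw [add_zero, hn, h0']
    · rw [Nat.add_sub_cancel_left]
  refine ⟨n + m, fun k => if k ≤ n then p k else p' (k - n), ?_, ?_, fun k hk => ?_, ?_⟩
  · exact (hlow 0 n.zero_le).trans h0
  · exact (hhigh m).trans hm
  · beta_reduce
    rcases lt_or_ge k n with h | h
    · rw [hlow k h.le, hlow (k + 1) h]
      exact hp k h
    · obtain ⟨l, rfl⟩ := Nat.exists_eq_add_of_le h
      rw [add_assoc, hhigh, hhigh]
      exact hp' l (by omega)
  · rw [Finset.prod_range_add, ← hq, ← hr]
    congr 1
    · refine Finset.prod_congr rfl fun k hk => ?_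
      rw [Finset.mem_range] at hk
      beta_reduce
      rw [hlow k hk.le, hlow (k + 1) hk]
    · refine Finset.prod_congr rfl fun k _ => ?_
      beta_reduce
      rw [add_assoc, hhigh, hhigh]

theorem Reach.loop_pow (v : Fin 4) (n : ℕ) : Reach v v (weight v v ^ n) := by
  induction n with
  | zero => simpa using Reach.refl v
  | succ n ih =>
    rw [pow_succ]
    exact ih.trans (.edge ⟨by omega, by omega⟩)

theorem Reach.step {v w : Fin 4} (h : Adj v w) (hne : v ≠ w) : Reach v w 1 := by
  simpa [weight, hne] using Reach.edge h

/-- The path is connected and its non-loop edges have weight 1, so changing vertex is free. -/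
theorem reach_one (v w : Fin 4) : Reach v w 1 := by
  have hd : ∀ {u v w}, Reach u v 1 → Reach v w 1 → Reach u w 1 := fun h h' => by
    simpa using h.trans h'
  have hv : ∀ v, Reach v 0 1 ∧ Reach 0 v 1 := by
    have h01 : Reach 0 1 1 := .step (by simp [Adj]) (by decide)
    have h12 : Reach 1 2 1 := .step (by simp [Adj]) (by decide)
    have h23 : Reach 2 3 1 := .step (by simp [Adj]) (by decide)
    have h10 : Reach 1 0 1 := .step (by simp [Adj]) (by decide)
    have h21 : Reach 2 1 1 := .step (by simp [Adj]) (by decide)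
    have h32 : Reach 3 2 1 := .step (by simp [Adj]) (by decide)
    intro v
    fin_cases v
    · exact ⟨.refl 0, .refl 0⟩
    · exact ⟨h10, h01⟩
    · exact ⟨hd h21 h10, hd h01 h12⟩
    · exact ⟨hd h32 (hd h21 h10), hd h01 (hd h12 h23)⟩
  exact hd (hv v).1 (hv w).2

/-- Travel freely to the loop of weight 2 or 1/2, according to the sign of `a`, repeat it, return to
0, and do the same with the loops of weight 3 and 1/3 for `b`. -/
theorem reach_of_isTwoThree (v w : Fin 4) {q : ℝ≥0} (hq : IsTwoThree q) : Reach v w q := by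
  have hl : ∀ (u v w : Fin 4) (n : ℕ), Reach v w (weight u u ^ n) := fun u v w n => by
    simpa using ((reach_one v u).trans (Reach.loop_pow u n)).trans (reach_one u w)
  obtain ⟨a, b, rfl⟩ := hq
  refine Reach.trans (v := 0) ?_ ?_
  · obtain ⟨n, rfl | rfl⟩ := a.eq_nat_or_neg
    · simpa [weight] using hl 0 v 0 n
    · simpa [weight] using hl 1 v 0 n
  · obtain ⟨n, rfl | rfl⟩ := b.eq_nat_or_neg
    · simpa [weight] using hl 2 0 w n
    · simpa [weight] using hl 3 0 w n

theorem irrational_log_two_div_log_three : Irrational (Real.log 2 / Real.log 3) := by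
  rintro ⟨q, hq⟩
  have h2 : 0 < Real.log 2 := Real.log_pos one_lt_two
  have h3 : 0 < Real.log 3 := Real.log_pos (by norm_num)
  have hq0 : 0 < q := by exact_mod_cast hq ▸ div_pos h2 h3
  obtain ⟨m, hm⟩ := Int.eq_ofNat_of_zero_le (Rat.num_pos.2 hq0).le
  have hden : (q.den : ℝ) ≠ 0 := by exact_mod_cast q.den_ne_zero
  have hlog : q.den * Real.log 2 = m * Real.log 3 := by
    rw [Rat.cast_def, hm, div_eq_div_iff hden h3.ne'] at hq
    push_cast at hq
    linarith
  rw [← Real.log_pow, ← Real.log_pow] at hlog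
  have hpow := Real.log_injOn_pos (by simp) (by simp) hlog
  have hnat : 2 ^ q.den = 3 ^ m := by exact_mod_cast hpow
  have heven : Even (3 ^ m) := hnat ▸ (Nat.even_pow.2 ⟨even_two, q.den_ne_zero⟩)
  exact Nat.not_even_iff_odd.2 (Odd.pow (by decide)) heven

/-- The logarithms of these numbers form the additive group generated by log 2 and log 3, dense
since the ratio is irrational. -/
theorem exists_isTwoThree_mem {V : Set ℝ} (hV : IsOpen V) {x : ℝ} (hx : x ∈ V) :
    ∃ q : ℝ≥0, IsTwoThree q ∧ Real.log q ∈ V := by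
  have hd := dense_addSubgroupClosure_pair_iff.2 irrational_log_two_div_log_three
  obtain ⟨y, hy, hyV⟩ := hd.exists_mem_open hV ⟨x, hx⟩
  obtain ⟨a, b, rfl⟩ := AddSubgroup.mem_closure_pair.1 hy
  refine ⟨2 ^ a * 3 ^ b, ⟨a, b, rfl⟩, ?_⟩
  have : Real.log ((2 ^ a * 3 ^ b : ℝ≥0) : ℝ) = a • Real.log 2 + b • Real.log 3 := by
    push_cast
    rw [Real.log_mul (by positivity) (by positivity), Real.log_zpow, Real.log_zpow]
    simp
  rwa [this]

theorem intCocycle_natCast (n : ℕ) (i : Itinerary ℤ) :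
    intCocycle.toFun n i = ∏ k ∈ Finset.range n, weight (i.1 k) (i.1 (k + 1)) := by
  induction n with
  | zero => simpa using intCocycle.zero i
  | succ n ih => rw [Finset.prod_range_succ, ← ih]; exact_mod_cast intCocycle.add_one n i

/-- Two itineraries can be glued by a walk between them such that the total exponent over the time
from `0` of the first one to `0` of the second one is prescribed. -/
theorem exists_itinerary_glue (i j : Itinerary ℤ) {K : ℕ} (hK : 0 < K) {q : ℝ≥0}
    (hq : IsTwoThree q) : ∃ (n : ℕ) (z : Itinerary ℤ), K < n ∧ (∀ k ≤ (K : ℤ), z.1 k = i.1 k) ∧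
      (∀ k ≥ -(K : ℤ), z.1 (k + n) = j.1 k) ∧ intCocycle.toFun n z = q := by
  have hprod : ∀ (s : Finset ℕ) (f : ℕ → Fin 4) (g : ℕ → Fin 4),
      IsTwoThree (∏ k ∈ s, weight (f k) (g k)) := fun s f g =>
    Finset.prod_induction _ _ (fun _ _ => .mul) .one fun _ _ => isTwoThree_weight _ _
  set A := ∏ k ∈ Finset.range K, weight (i.1 k) (i.1 (k + 1)) with hA
  set B := ∏ k ∈ Finset.range K, weight (j.1 (-K + k)) (j.1 (-K + k + 1)) with hB
  have hA0 : A ≠ 0 := (Finset.prod_pos fun _ _ => weight_pos _ _).ne'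
  have hB0 : B ≠ 0 := (Finset.prod_pos fun _ _ => weight_pos _ _).ne'
  -- The stretches of `i` over `[0, K]` and of `j` over `[-K, 0]` contribute `A` and `B`; the
  -- connecting walk must compensate for both.
  obtain ⟨L, p, h0, hL, hp, hQ⟩ := reach_of_isTwoThree (i.1 K) (j.1 (-K))
    ((hq.mul (hprod _ _ _).inv).mul (hprod _ _ _).inv : IsTwoThree (q * A⁻¹ * B⁻¹))
  -- Follow `i` up to time `K`, then `p` for `L` steps, then `j` from its time `-K` on. Time 0 of
  -- `j` becomes `2 * K + L`.
  let f : ℤ → Fin 4 := fun k =>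
    if k ≤ K then i.1 k else if k ≤ K + L then p (k - K).toNat else j.1 (k - (2 * K + L))
  have f1 : ∀ k ≤ (K : ℤ), f k = i.1 k := fun k hk => if_pos hk
  have f2 : ∀ l : ℕ, l ≤ L → f (K + l) = p l := by
    intro l hl
    rcases Nat.eq_zero_or_pos l with rfl | hpos
    · rw [f1 _ (by simp), h0]; simp
    · simp only [f]
      rw [if_neg (by omega), if_pos (by omega)]
      congr 1
      omega
  have f3 : ∀ k ≥ -(K : ℤ), f (k + (2 * K + L)) = j.1 k := by
    intro k hk
    rcases eq_or_lt_of_le hk with rfl | hlt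
    · rw [← hL, ← f2 L le_rfl]
      exact congrArg f (by ring)
    · simp only [f]
      rw [if_neg (by omega), if_neg (by omega)]
      exact congrArg j.1 (by ring)
  have hf : ∀ k, Adj (f k) (f (k + 1)) := by
    intro k
    by_cases h1 : k + 1 ≤ K
    · rw [f1 _ h1, f1 _ (by omega)]
      exact i.2 k
    by_cases h2 : k + 1 ≤ K + L
    · obtain ⟨l, rfl⟩ : ∃ l : ℕ, k = K + l := ⟨(k - K).toNat, by omega⟩
      have := f2 (l + 1) (by omega)
      rw [add_assoc, f2 l (by omega)]
      push_cast at this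
      rw [this]
      exact hp l (by omega)
    · obtain ⟨l, rfl⟩ : ∃ l : ℤ, k = l + (2 * K + L) := ⟨k - (2 * K + L), by ring⟩
      rw [f3 _ (by omega), add_right_comm, f3 _ (by omega)]
      exact j.2 l
  refine ⟨K + L + K, ⟨f, hf⟩, by omega, f1, fun k hk => ?_, ?_⟩
  · rw [← f3 k hk]
    exact congrArg f (by push_cast; ring)
  · rw [intCocycle_natCast, Finset.prod_range_add, Finset.prod_range_add]
    have e1 : ∏ k ∈ Finset.range K, weight (f k) (f (k + 1)) = A :=
      Finset.prod_congr rfl fun k hk => by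
        rw [Finset.mem_range] at hk
        rw [f1 _ (by omega), f1 _ (by omega)]
    have e2 : ∏ k ∈ Finset.range L, weight (f (K + k : ℕ)) (f ((K + k : ℕ) + 1)) =
        q * A⁻¹ * B⁻¹ := by
      rw [← hQ]
      refine Finset.prod_congr rfl fun k hk => ?_
      rw [Finset.mem_range] at hk
      have := f2 (k + 1) (by omega)
      push_cast at this ⊢
      rw [f2 k hk.le, add_assoc, this]
    have e3 : ∏ k ∈ Finset.range K, weight (f (K + L + k : ℕ)) (f ((K + L + k : ℕ) + 1)) = B := by
      refine Finset.prod_congr rfl fun k hk => ?_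
      rw [Finset.mem_range] at hk
      rw [← f3 (-K + k) (by omega), ← f3 (-K + k + 1) (by omega)]
      congr 2 <;> push_cast <;> ring
    rw [e1, e2, e3]
    field_simp

/-- An itinerary can be approximated by periodic ones with trivial exponent over the period. -/
theorem exists_itinerary_periodic (i : Itinerary ℤ) {K : ℕ} (hK : 0 < K) :
    ∃ (n : ℕ) (y : Itinerary ℤ), 0 < n ∧ (∀ k, |k| ≤ (K : ℤ) → y.1 k = i.1 k) ∧
      (∀ k, y.1 (k + n) = y.1 k) ∧ intCocycle.toFun n y = 1 := by
  -- The block of `z` over `[0, n)` closes up, and is repeated periodically.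
  obtain ⟨n, z, hn, h1, h2, h3⟩ := exists_itinerary_glue i i hK .one
  have hz : z.1 n = z.1 0 := by
    have := h2 0 (by omega)
    rw [zero_add] at this
    rw [this, h1 0 (by omega)]
  have hmod : ∀ k, z.1 ((k + 1) % n) = z.1 (k % n + 1) := by
    intro k
    have hlt := Int.emod_lt_of_pos k (by omega : (0 : ℤ) < n)
    have hnn := Int.emod_nonneg k (by omega : (n : ℤ) ≠ 0)
    rcases eq_or_lt_of_le (Int.add_one_le_of_lt hlt) with h | h
    · rw [h, hz, ← Int.emod_add_emod, h, Int.emod_self]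
    · rw [← Int.emod_add_emod, Int.emod_eq_of_lt (by omega) h]
  have hlow : ∀ k : ℤ, 0 ≤ k → k < n → z.1 (k % n) = z.1 k := fun k h0 h => by
    rw [Int.emod_eq_of_lt h0 h]
  refine ⟨n, ⟨fun k => z.1 (k % n), fun k => ?_⟩, by omega, fun k hk => ?_, fun k => ?_, ?_⟩
  · beta_reduce
    rw [hmod]
    exact z.2 _
  · rw [abs_le] at hk
    change z.1 (k % n) = i.1 k
    rcases le_or_gt 0 k with h | h
    · rw [hlow k h (by omega), h1 k hk.2]
    -- A negative time `k` reduces to `k + n`, where `z` runs through the second copy of `i`; `K <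
    -- n` keeps this inside the block.
    · rw [← h2 k hk.1, ← Int.add_emod_right, hlow _ (by omega) (by omega)]
  · simp
  · rw [← h3, intCocycle_natCast, intCocycle_natCast]
    refine Finset.prod_congr rfl fun k hk => ?_
    rw [Finset.mem_range] at hk
    change weight (z.1 (k % n)) (z.1 ((k + 1) % n)) = _
    rw [hmod, Int.emod_eq_of_lt (by omega) (by omega)]

/-! ### Chaos and factor maps -/

theorem DevaneyChaotic.of_semiconj {X Y : Type*} [TopologicalSpace X] [TopologicalSpace Y]
    {f : X → X} {g : Y → Y} {π : X → Y} (hf : DevaneyChaotic f) (hπ : Continuous π)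
    (hsurj : Function.Surjective π) (h : Function.Semiconj π f g) : DevaneyChaotic g := by
  constructor
  · intro U V hU hUne hV hVne
    obtain ⟨n, -, ⟨x, hx, rfl⟩, hxV⟩ := hf.1 (π ⁻¹' U) (π ⁻¹' V) (hU.preimage hπ)
      (hUne.preimage hsurj) (hV.preimage hπ) (hVne.preimage hsurj)
    exact ⟨n, _, ⟨π x, hx, rfl⟩, by rwa [← (h.iterate_right n) x]⟩
  · refine (hsurj.denseRange.dense_image hπ hf.2).mono ?_
    rintro _ ⟨x, hx, rfl⟩
    exact h.mapsTo_periodicPts hx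

/-! ### The two-sided shift is chaotic -/

/-- Points of the two-sided Mahavier product as pairs of an itinerary and a height. -/
noncomputable def twoSidedHomeomorph :
    Itinerary ℤ × unitInterval ≃ₜ TwoSidedMahavierProduct relF :=
  intCocycle.homeomorph

theorem twoSidedHomeomorph_apply (i : Itinerary ℤ) (t : unitInterval) (k : ℤ) :
    (twoSidedHomeomorph (i, t)).1 k = chart (i.1 k, unitPow (intCocycle.toFun k i) t) := rfl

/-- The shift of an itinerary by `n`. -/
def Itinerary.shiftBy (i : Itinerary ℤ) (n : ℤ) : Itinerary ℤ :=
  ⟨fun k => i.1 (k + n), fun k => by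
    beta_reduce
    rw [add_right_comm]
    exact i.2 (k + n)⟩

theorem iterate_twoSidedShift_apply {X : Type*} (F : Set (X × X)) (n : ℕ)
    (x : TwoSidedMahavierProduct F) (k : ℤ) : ((twoSidedShift F)^[n] x).1 k = x.1 (k + n) := by
  induction n generalizing x with
  | zero => simp
  | succ n ih =>
    rw [Function.iterate_succ_apply, ih]
    change x.1 (k + n + 1) = _
    rw [add_assoc]
    norm_cast

theorem iterate_twoSidedShift_homeomorph (n : ℕ) (i : Itinerary ℤ) (t : unitInterval) :
    (twoSidedShift relF)^[n] (twoSidedHomeomorph (i, t)) =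
      twoSidedHomeomorph (i.shiftBy n, unitPow (intCocycle.toFun n i) t) := by
  have key : ∀ x : TwoSidedMahavierProduct relF, twoSidedHomeomorph.symm x =
      (⟨fun k => (chart.symm (x.1 k)).1, fun k => ((mem_relF_iff _ _).1 (x.2 k)).1⟩,
        (chart.symm (x.1 0)).2) := fun _ => rfl
  rw [← twoSidedHomeomorph.symm.injective.eq_iff, Homeomorph.symm_apply_apply, key]
  simp only [iterate_twoSidedShift_apply, twoSidedHomeomorph_apply, Homeomorph.symm_apply_apply,
    zero_add]
  rfl

/-- Nonempty open sets contain boxes around points of intermediate height. -/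
theorem exists_box {U : Set (TwoSidedMahavierProduct relF)} (hU : IsOpen U) (hne : U.Nonempty) :
    ∃ (i : Itinerary ℤ) (t : unitInterval) (J : Set unitInterval) (K : ℕ), 0 < t ∧ t < 1 ∧
      IsOpen J ∧ t ∈ J ∧ ∀ j : Itinerary ℤ, (∀ k, |k| ≤ (K : ℤ) → j.1 k = i.1 k) →
        ∀ s ∈ J, twoSidedHomeomorph (j, s) ∈ U := by
  obtain ⟨x, hx⟩ := hne
  obtain ⟨⟨i, s⟩, rfl⟩ := twoSidedHomeomorph.surjective x
  obtain ⟨A, J, hA, hiA, hJ, hsJ, hAJ⟩ := mem_nhds_prod_iff'.1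
    ((hU.preimage twoSidedHomeomorph.continuous).mem_nhds hx)
  obtain ⟨F, hF⟩ := exists_finset_of_mem_nhds (hA.mem_nhds hiA)
  -- Heights 0 and 1 are fixed by all positive powers and must be avoided; the open interval is
  -- dense.
  obtain ⟨t, htJ, ht0, ht1⟩ : ∃ t ∈ J, 0 < t ∧ t < 1 := by
    obtain ⟨B, hB, rfl⟩ := isOpen_induced_iff.1 hJ
    have hs : (s : ℝ) ∈ closure (Ioo 0 1) := by
      rw [closure_Ioo zero_ne_one]
      exact s.2
    obtain ⟨t, htB, ht⟩ := mem_closure_iff.1 hs B hB hsJ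
    exact ⟨⟨t, ht.1.le, ht.2.le⟩, htB, ht.1, ht.2⟩
  refine ⟨i, t, J, F.sup Int.natAbs, ht0, ht1, hJ, htJ, fun j hj u hu => hAJ ⟨hF j ?_, hu⟩⟩
  intro k hk
  refine hj k ?_
  have : k.natAbs ≤ F.sup Int.natAbs := Finset.le_sup (f := Int.natAbs) hk
  rw [Int.abs_eq_natAbs]
  exact_mod_cast this

/-- The exponent `logb t s` is positive and carries `t` exactly to `s`; by density and continuity it
can be replaced by some `2 ^ a * 3 ^ b`. -/
theorem exists_unitPow_mem {t s : unitInterval} (ht0 : 0 < t) (ht1 : t < 1) (hs0 : 0 < s)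
    (hs1 : s < 1) {J : Set unitInterval} (hJ : IsOpen J) (hs : s ∈ J) :
    ∃ q : ℝ≥0, IsTwoThree q ∧ unitPow q t ∈ J := by
  let c : ℝ → ℝ≥0 := fun x => ⟨Real.exp x, (Real.exp_pos x).le⟩
  have hc : Continuous c := Real.continuous_exp.subtype_mk _
  have hcont : Continuous fun x => unitPow (c x) t :=
    continuous_unitPow hc continuous_const fun x => Real.exp_pos x
  have ht0' : (0 : ℝ) < t := ht0
  have ht1' : (t : ℝ) < 1 := ht1
  have hs0' : (0 : ℝ) < s := hs0
  have hpos : 0 < Real.logb t s :=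
    Real.logb_pos_of_base_lt_one ht0' ht1' hs0 hs1
  have hx : unitPow (c (Real.log (Real.logb t s))) t = s := by
    ext
    change (t : ℝ) ^ Real.exp (Real.log (Real.logb t s)) = s
    rw [Real.exp_log hpos, Real.rpow_logb ht0' ht1'.ne hs0]
  obtain ⟨q, hq, hqJ⟩ := exists_isTwoThree_mem (hJ.preimage hcont)
    (show Real.log (Real.logb t s) ∈ _ by rw [mem_preimage, hx]; exact hs)
  refine ⟨q, hq, ?_⟩
  have hq0 : (0 : ℝ) < q := by
    obtain ⟨a, b, rfl⟩ := hq
    positivity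
  have : c (Real.log q) = q := NNReal.eq (Real.exp_log hq0)
  rwa [mem_preimage, this] at hqJ

theorem devaneyChaotic_twoSidedShift : DevaneyChaotic (twoSidedShift relF) := by
  constructor
  · intro U V hU hUne hV hVne
    obtain ⟨i, t, J, K, ht0, ht1, -, htJ, hUK⟩ := exists_box hU hUne
    obtain ⟨j, s, J', K', hs0, hs1, hJ', hsJ', hVK⟩ := exists_box hV hVne
    obtain ⟨q, hq, hqJ⟩ := exists_unitPow_mem ht0 ht1 hs0 hs1 hJ' hsJ'
    -- One window covers both boxes, and the extra 1 makes it positive. The point `(z, t)` starts in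
    -- `U`; at time `n` its walk is near `j` and its height is `t ^ q`.
    obtain ⟨n, z, -, h1, h2, h3⟩ := exists_itinerary_glue i j (K := K + K' + 1) (by omega) hq
    refine ⟨n, _, ⟨_, hUK z (fun k hk => h1 k ?_) t htJ, rfl⟩, ?_⟩
    · rw [abs_le] at hk
      push_cast
      omega
    · rw [iterate_twoSidedShift_homeomorph, h3]
      refine hVK _ (fun k hk => h2 k ?_) _ hqJ
      rw [abs_le] at hk
      push_cast
      omega
  · rw [dense_iff_inter_open]
    intro U hU hUne
    obtain ⟨i, t, J, K, -, -, -, htJ, hUK⟩ := exists_box hU hUne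
    obtain ⟨n, y, hn, h1, h2, h3⟩ := exists_itinerary_periodic i (K := K + 1) (by omega)
    refine ⟨_, hUK y (fun k hk => h1 k (hk.trans (by push_cast; omega))) t htJ,
      Function.mk_mem_periodicPts hn ?_⟩
    have hy : y.shiftBy n = y := Subtype.ext (funext h2)
    rw [Function.IsPeriodicPt, Function.IsFixedPt, iterate_twoSidedShift_homeomorph, h3,
      unitPow_one, hy]

/-! ### The one-sided shift is a factor -/

/-- Forgetting the coordinates with negative index. -/
def restrictNat {X : Type*} (F : Set (X × X)) (x : TwoSidedMahavierProduct F) :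
    MahavierProduct F :=
  ⟨fun n => x.1 n, fun n => by exact_mod_cast x.2 n⟩

theorem continuous_oneSided_apply {X : Type*} [TopologicalSpace X] (F : Set (X × X)) (n : ℕ) :
    Continuous fun x : MahavierProduct F => x.1 n :=
  (continuous_apply n).comp continuous_induced_dom

theorem continuous_twoSided_apply {X : Type*} [TopologicalSpace X] (F : Set (X × X)) (n : ℤ) :
    Continuous fun x : TwoSidedMahavierProduct F => x.1 n :=
  (continuous_apply n).comp continuous_induced_dom

theorem continuous_restrictNat {X : Type*} [TopologicalSpace X] (F : Set (X × X)) :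
    Continuous (restrictNat F) :=
  continuous_induced_rng.2 (continuous_pi fun n => continuous_twoSided_apply F n)

theorem semiconj_restrictNat {X : Type*} (F : Set (X × X)) :
    Function.Semiconj (restrictNat F) (twoSidedShift F) (shift F) := fun x =>
  Subtype.ext (funext fun n => by
    change x.1 (n + 1) = x.1 ((n + 1 : ℕ) : ℤ)
    norm_cast)

theorem restrictNat_surjective : Function.Surjective (restrictNat relF) := by
  intro x
  obtain ⟨⟨i, t⟩, rfl⟩ := natCocycle.homeomorph.surjective x
  -- Extend the walk to the past by staying at its first vertex, using the loop there.
  let z : Itinerary ℤ := ⟨fun k => i.1 k.toNat, fun k => by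
    beta_reduce
    rcases le_or_gt 0 k with h | h
    · rw [Int.toNat_add h zero_le_one]
      exact i.2 k.toNat
    · rw [Int.toNat_of_nonpos h.le, Int.toNat_of_nonpos (by omega)]
      exact ⟨by omega, by omega⟩⟩
  refine ⟨twoSidedHomeomorph (z, t), Subtype.ext (funext fun n => ?_)⟩
  change chart (i.1 n, unitPow (intCocycle.toFun n z) t) =
    chart (i.1 n, unitPow (natCocycle.toFun n i) t)
  rw [intCocycle_natCast]
  rfl

theorem devaneyChaotic_shift : DevaneyChaotic (shift relF) :=
  devaneyChaotic_twoSidedShift.of_semiconj (continuous_restrictNat relF) restrictNat_surjective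
    (semiconj_restrictNat relF)

/-! ### The quotient shifts -/

theorem continuous_shift {X : Type*} [TopologicalSpace X] (F : Set (X × X)) :
    Continuous (shift F) :=
  continuous_induced_rng.2 (continuous_pi fun n => continuous_oneSided_apply F (n + 1))

theorem continuous_twoSidedShift {X : Type*} [TopologicalSpace X] (F : Set (X × X)) :
    Continuous (twoSidedShift F) :=
  continuous_induced_rng.2 (continuous_pi fun n => continuous_twoSided_apply F (n + 1))

theorem continuous_quotientShift {X : Type*} [TopologicalSpace X] (F : Set (X × X)) (A : Set X) :
    Continuous (quotientShift F A) :=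
  (continuous_quotient_mk'.comp (continuous_shift F)).quotient_lift _

theorem continuous_twoSidedQuotientShift {X : Type*} [TopologicalSpace X] (F : Set (X × X))
    (A : Set X) : Continuous (twoSidedQuotientShift F A) :=
  (continuous_quotient_mk'.comp (continuous_twoSidedShift F)).quotient_lift _

theorem twoSidedShift_bijective {X : Type*} (F : Set (X × X)) :
    Function.Bijective (twoSidedShift F) := by
  constructor
  · intro x y h
    refine Subtype.ext (funext fun k => ?_)
    have : x.1 (k - 1 + 1) = y.1 (k - 1 + 1) := congrFun (congrArg Subtype.val h) (k - 1)
    rwa [sub_add_cancel] at this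
  · intro x
    refine ⟨⟨fun k => x.1 (k - 1), fun k => ?_⟩, Subtype.ext (funext fun k => ?_)⟩
    · have := x.2 (k - 1)
      rw [sub_add_cancel] at this
      beta_reduce
      rwa [add_sub_cancel_right]
    · exact congrArg x.1 (add_sub_cancel_right k 1)

/-- Injectivity survives the quotient because the collapsed set is also invariant under the inverse
shift. -/
theorem twoSidedQuotientShift_bijective {X : Type*} (F : Set (X × X)) (A : Set X) :
    Function.Bijective (twoSidedQuotientShift F A) := by
  constructor
  · rintro ⟨x⟩ ⟨y⟩ h
    refine Quotient.sound ?_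
    rcases Quotient.exact h with h | h
    · exact Or.inl ((twoSidedShift_bijective F).1 h)
    · refine Or.inr fun k => ?_
      have := h (k - 1)
      change {x.1 (k - 1 + 1), y.1 (k - 1 + 1)} ⊆ A at this
      rwa [sub_add_cancel] at this
  · rintro ⟨x⟩
    obtain ⟨y, rfl⟩ := (twoSidedShift_bijective F).2 x
    exact ⟨Quotient.mk _ y, rfl⟩

/-- Two walks that differ only at index 0, both at height 1, become equal after one shift. Powers
fix 1, so neither point is collapsed. -/
theorem quotientShift_not_injective :
    ¬ Function.Injective (quotientShift relF bottomPoints) := by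
  intro hinj
  let i : Itinerary ℕ := ⟨fun _ => 0, fun _ => ⟨zero_le_one, zero_le_one⟩⟩
  let j : Itinerary ℕ := ⟨fun k => if k = 0 then 1 else 0, fun k => by
    by_cases hk : k = 0 <;> simp [hk, Adj]⟩
  let x : MahavierProduct relF := natCocycle.homeomorph (i, 1)
  let y : MahavierProduct relF := natCocycle.homeomorph (j, 1)
  have hone : ∀ c, unitPow c 1 = 1 := fun c => by ext; simp [unitPow]
  have hx : ∀ k, x.1 k = chart (i.1 k, 1) := fun k => by
    rw [← hone]; exact natCocycle.homeomorph_apply i 1 k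
  have hy : ∀ k, y.1 k = chart (j.1 k, 1) := fun k => by
    rw [← hone]; exact natCocycle.homeomorph_apply j 1 k
  have hshift : shift relF x = shift relF y := Subtype.ext (funext fun k => by
    change x.1 (k + 1) = y.1 (k + 1)
    rw [hx, hy]
    simp [i, j])
  have hxy : quotientShift relF bottomPoints (Quotient.mk _ x) =
      quotientShift relF bottomPoints (Quotient.mk _ y) :=
    congrArg (Quotient.mk (collapse relF bottomPoints)) hshift
  rcases Quotient.exact (hinj hxy) with h | h
  · have := congrFun (congrArg Subtype.val h) 0
    rw [hx, hy, chart.injective.eq_iff] at this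
    simp [i, j] at this
  · have := (pair_subset_iff.1 (h 0)).1
    rw [hx, chart_mem_bottomPoints] at this
    exact one_ne_zero this

end CantorFanChaos

/-! ### The main theorem -/

open CantorFanChaos in
theorem mainTheorem4 {C : Type*} [TopologicalSpace C] (hC : CantorFanChaos.IsCantorFan C) :
    (∃ f : C → C, Continuous f ∧ ¬ IsHomeomorph f ∧ CantorFanChaos.DevaneyChaotic f ∧
      CantorFanChaos.TopConjugate
        (CantorFanChaos.quotientShift CantorFanChaos.relF CantorFanChaos.bottomPoints) f) ∧
    (∃ h : C ≃ₜ C, CantorFanChaos.DevaneyChaotic h ∧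
      CantorFanChaos.TopConjugate
        (CantorFanChaos.twoSidedQuotientShift CantorFanChaos.relF CantorFanChaos.bottomPoints)
        h) := by
  constructor
  · obtain ⟨φ⟩ := nonempty_collapse_homeomorph hC
    have hsemi : Function.Semiconj φ (quotientShift relF bottomPoints)
        (φ ∘ quotientShift relF bottomPoints ∘ φ.symm) := fun x => by simp
    refine ⟨φ ∘ quotientShift relF bottomPoints ∘ φ.symm,
      φ.continuous.comp ((continuous_quotientShift _ _).comp φ.symm.continuous), fun h => ?_,
      (devaneyChaotic_shift.of_semiconj continuous_quotient_mk' Quotient.mk_surjective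
        fun _ => rfl).of_semiconj φ.continuous φ.surjective hsemi, φ, hsemi.comp_eq⟩
    refine quotientShift_not_injective fun x y hxy => ?_
    have := h.injective (a₁ := φ x) (a₂ := φ y) (by simp [hxy])
    exact φ.injective this
  · obtain ⟨φ⟩ := nonempty_twoSidedCollapse_homeomorph hC
    have hcompact : CompactSpace (TwoSidedMahavierProduct relF) := twoSidedHomeomorph.compactSpace
    -- The quotient inherits the Hausdorff property from the plane, so the continuous bijection on
    -- this compact space is a homeomorphism.
    have : T2Space (Quotient (twoSidedCollapse relF bottomPoints)) := by
      obtain ⟨K, -, -, ⟨c⟩⟩ := hC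
      exact (φ.trans c).symm.t2Space
    let s : Quotient (twoSidedCollapse relF bottomPoints) ≃ₜ
        Quotient (twoSidedCollapse relF bottomPoints) :=
      (continuous_twoSidedQuotientShift relF bottomPoints).homeoOfEquivCompactToT2
        (f := Equiv.ofBijective _ (twoSidedQuotientShift_bijective relF bottomPoints))
    have hsemi : Function.Semiconj φ (twoSidedQuotientShift relF bottomPoints)
        ((φ.symm.trans s).trans φ) := fun x => by
      change _ = φ (twoSidedQuotientShift relF bottomPoints (φ.symm (φ x)))
      rw [φ.symm_apply_apply]
    exact ⟨(φ.symm.trans s).trans φ,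
      (devaneyChaotic_twoSidedShift.of_semiconj continuous_quotient_mk' Quotient.mk_surjective
        fun _ => rfl).of_semiconj φ.continuous φ.surjective hsemi, φ, hsemi.comp_eq⟩
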